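/- Let $G$ be a locally compact, $\sigma$-compact topological group. A $G$-$C^*$-algebra is a (complex, not necessarily unital) $C^*$-algebra $A$ with an action $\alpha$ of $G$ by $*$-automorphisms such that $g\mapsto \alpha_g(a)$ is norm-continuous for every $a\in A$; it is $\sigma$-unital if it has a sequential approximate unit of increasing positive contractions. Write $\mathcal M(A)$ for the multiplier algebra of $A$, and write $g\cdot m$ for the image of $m\in\mathcal M(A)$ under the extension of the automorphism $\alpha_g$ to $\mathcal M(A)$. Let $$0\to J\to A\stackrel{\pi}{\to} B\to 0$$ be an extension of $\sigma$-unital $G$-$C^*$-algebras, that is, a short exact sequence of $G$-equivariant $*$-homomorphisms in which $J$, $A$ and $B$ are $\sigma$-unital $G$-$C^*$-algebras; regard $J\subseteq A\subseteq\mathcal M(A)$. Let $\pi^\circ:\mathcal M(A)\to\mathcal M(B)$ be the induced $*$-homomorphism, determined by $\pi^\circ(m)\pi(a)=\pi(ma)$ and $\pi(a)\pi^\circ(m)=\pi(am)$ for $m\in\mathcal M(A)$, $a\in A$. Let $X\subseteq\mathcal M(A)$ be a norm-separable self-adjoint linear subspace. Then for every $z\in\mathcal M(B)$ that commutes with every element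 of $\pi^\circ(X)$ and satisfies $g\cdot z=z$ for all $g\in G$, there exists $y\in\mathcal M(A)$ such that 1. $\pi^\circ(y)=z$; 2. $[y,x]=yx-xy\in J$ for all $x\in X$; 3. $g\cdot y-y\in J$ for all $g\in G$; 4. the map $G\to\mathcal M(A)$, $g\mapsto g\cdot y$, is norm-continuous. -/

import Mathlib

open Filter Topology
open scoped MultiplierAlgebra CStarAlgebra

noncomputable section

section MultiplierExtension

variable {A B : Type*} [NonUnitalCStarAlgebra A] [NonUnitalCStarAlgebra B]

/-- A multiplier maps the kernel of a `*`-homomorphism into itself (left multiplication). -/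
theorem DoubleCentralizer.map_fst_eq_zero (φ : A →⋆ₙₐ[ℂ] B) (m : 𝓜(ℂ, A)) (a : A)
    (ha : φ a = 0) : φ (m.fst a) = 0 := by
  rw [← CStarRing.star_mul_self_eq_zero_iff, ← map_star, ← map_mul, ← m.central, map_mul, ha,
    mul_zero]

/-- A multiplier maps the kernel of a `*`-homomorphism into itself (right multiplication). -/
theorem DoubleCentralizer.map_snd_eq_zero (φ : A →⋆ₙₐ[ℂ] B) (m : 𝓜(ℂ, A)) (a : A)
    (ha : φ a = 0) : φ (m.snd a) = 0 := by
  rw [← CStarRing.mul_star_self_eq_zero_iff, ← map_star, ← map_mul, m.central, map_mul, ha,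
    zero_mul]

theorem NonUnitalStarAlgHom.descend_spec (φ : A →⋆ₙₐ[ℂ] B) (hφ : Function.Surjective φ)
    (T : A →L[ℂ] A) (hT : ∀ a, φ a = 0 → φ (T a) = 0) (a : A) :
    φ (T (Function.surjInv hφ (φ a))) = φ (T a) := by
  rw [← sub_eq_zero, ← map_sub, ← map_sub]
  exact hT _ (by rw [map_sub, Function.surjInv_eq hφ, sub_self])

/-- The operator on `B` induced by an operator `T` on `A` that leaves the kernel of the surjection
`φ : A → B` invariant; it satisfies `descend T (φ a) = φ (T a)`. -/
def NonUnitalStarAlgHom.descend (φ : A →⋆ₙₐ[ℂ] B) (hφ : Function.Surjective φ)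
    (T : A →L[ℂ] A) (hT : ∀ a, φ a = 0 → φ (T a) = 0) : B →L[ℂ] B where
  toFun b := φ (T (Function.surjInv hφ b))
  map_add' b c := by
    obtain ⟨b, rfl⟩ := hφ b
    obtain ⟨c, rfl⟩ := hφ c
    rw [← map_add φ b c, descend_spec φ hφ T hT, descend_spec φ hφ T hT, descend_spec φ hφ T hT,
      map_add, map_add]
  map_smul' r b := by
    obtain ⟨b, rfl⟩ := hφ b
    rw [← map_smul φ r b, descend_spec φ hφ T hT, descend_spec φ hφ T hT, map_smul, map_smul,
      RingHom.id_apply]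
  cont := by
    have hq : IsQuotientMap φ :=
      ContinuousLinearMap.isQuotientMap ⟨(φ : A →ₗ[ℂ] B), map_continuous φ⟩ hφ
    change Continuous fun b => φ (T (Function.surjInv hφ b))
    rw [hq.continuous_iff]
    have : ((fun b => φ (T (Function.surjInv hφ b))) ∘ φ) = fun a => φ (T a) :=
      funext fun a => NonUnitalStarAlgHom.descend_spec φ hφ T hT a
    rw [this]
    exact hq.continuous.comp T.continuous

theorem NonUnitalStarAlgHom.descend_apply (φ : A →⋆ₙₐ[ℂ] B) (hφ : Function.Surjective φ)
    (T : A →L[ℂ] A) (hT : ∀ a, φ a = 0 → φ (T a) = 0) (a : A) :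
    φ.descend hφ T hT (φ a) = φ (T a) :=
  NonUnitalStarAlgHom.descend_spec φ hφ T hT a

/-- The extension `φ° : M(A) → M(B)` of a surjective `*`-homomorphism `φ : A → B` to the multiplier
algebras: the unique map with `φ°(m) φ(a) = φ(m a)` and `φ(a) φ°(m) = φ(a m)`. -/
def multiplierMap (φ : A →⋆ₙₐ[ℂ] B) (hφ : Function.Surjective φ) :
    𝓜(ℂ, A) →⋆ₐ[ℂ] 𝓜(ℂ, B) where
  toFun m :=
    { fst := φ.descend hφ m.fst (m.map_fst_eq_zero φ)
      snd := φ.descend hφ m.snd (m.map_snd_eq_zero φ)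
      central := fun x y => by
        obtain ⟨x, rfl⟩ := hφ x
        obtain ⟨y, rfl⟩ := hφ y
        simp only [NonUnitalStarAlgHom.descend_apply, ← map_mul, m.central] }
  map_one' := by
    ext b <;> obtain ⟨b, rfl⟩ := hφ b <;> simp [NonUnitalStarAlgHom.descend_apply]
  map_mul' m n := by
    ext b <;> obtain ⟨b, rfl⟩ := hφ b <;> simp [NonUnitalStarAlgHom.descend_apply]
  map_zero' := by
    ext b <;> obtain ⟨b, rfl⟩ := hφ b <;> simp [NonUnitalStarAlgHom.descend_apply]
  map_add' m n := by
    ext b <;> obtain ⟨b, rfl⟩ := hφ b <;> simp [NonUnitalStarAlgHom.descend_apply]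
  commutes' r := by
    ext b <;> obtain ⟨b, rfl⟩ := hφ b <;>
      simp [NonUnitalStarAlgHom.descend_apply, Algebra.algebraMap_eq_smul_one]
  map_star' m := by
    ext b <;> obtain ⟨b, rfl⟩ := hφ b <;>
      simp [NonUnitalStarAlgHom.descend_apply, ← map_star]

theorem multiplierMap_fst (φ : A →⋆ₙₐ[ℂ] B) (hφ : Function.Surjective φ) (m : 𝓜(ℂ, A)) (a : A) :
    (multiplierMap φ hφ m).fst (φ a) = φ (m.fst a) :=
  NonUnitalStarAlgHom.descend_apply φ hφ m.fst (m.map_fst_eq_zero φ) a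

theorem multiplierMap_snd (φ : A →⋆ₙₐ[ℂ] B) (hφ : Function.Surjective φ) (m : 𝓜(ℂ, A)) (a : A) :
    (multiplierMap φ hφ m).snd (φ a) = φ (m.snd a) :=
  NonUnitalStarAlgHom.descend_apply φ hφ m.snd (m.map_snd_eq_zero φ) a

end MultiplierExtension

/-- A C⋆-algebra is `σ`-unital if it has a sequential (positive, increasing, contractive)
approximate unit. The order is the usual one of a C⋆-algebra. -/
def IsSigmaUnital (A : Type*) [NonUnitalCStarAlgebra A] : Prop :=
  letI : PartialOrder A := CStarAlgebra.spectralOrder A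
  ∃ e : ℕ → A, Monotone e ∧ (∀ n, 0 ≤ e n ∧ ‖e n‖ ≤ 1) ∧ (map e atTop).IsApproximateUnit

/-- A point-norm continuous action of a topological group `G` on a C⋆-algebra `A` by
`*`-automorphisms, that is, the structure of a `G`-C⋆-algebra on `A`. -/
structure CStarAction (G A : Type*) [Group G] [TopologicalSpace G]
    [NonUnitalCStarAlgebra A] where
  /-- The automorphism by which a group element acts. -/
  aut : G →* (A ≃⋆ₐ[ℂ] A)
  continuous_apply : ∀ a : A, Continuous fun g => aut g a

/-- The extension of the action to the multiplier algebra: `g · m` is the image of `m` under the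
extension to `M(A)` of the automorphism by which `g` acts on `A`. -/
def CStarAction.onMultiplier {G A : Type*} [Group G] [TopologicalSpace G]
    [NonUnitalCStarAlgebra A] (α : CStarAction G A) (g : G) : 𝓜(ℂ, A) →⋆ₐ[ℂ] 𝓜(ℂ, A) :=
  multiplierMap (α.aut g).toNonUnitalStarAlgHom (EquivLike.surjective (α.aut g))

/-- `0 → J → A → B → 0` is an extension of `G`-C⋆-algebras: a short exact sequence of
`G`-equivariant `*`-homomorphisms. -/
structure IsEquivariantExtension {G J A B : Type*} [Group G] [TopologicalSpace G]
    [NonUnitalCStarAlgebra J] [NonUnitalCStarAlgebra A] [NonUnitalCStarAlgebra B]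
    (γ : CStarAction G J) (α : CStarAction G A) (β : CStarAction G B)
    (ι : J →⋆ₙₐ[ℂ] A) (π : A →⋆ₙₐ[ℂ] B) : Prop where
  injective : Function.Injective ι
  exact : ∀ a : A, π a = 0 ↔ a ∈ Set.range ι
  surjective : Function.Surjective π
  equivariant_left : ∀ (g : G) (j : J), ι (γ.aut g j) = α.aut g (ι j)
  equivariant_right : ∀ (g : G) (a : A), π (α.aut g a) = β.aut g (π a)

/-- The image of the ideal `J` of `A` in the multiplier algebra `M(A)`. -/
def idealInMultiplier {J A : Type*} [NonUnitalCStarAlgebra J] [NonUnitalCStarAlgebra A]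
    (ι : J →⋆ₙₐ[ℂ] A) : Set 𝓜(ℂ, A) :=
  Set.range fun j => DoubleCentralizer.coeHom (𝕜 := ℂ) (ι j)

end

/-! Let `E` be an increasing approximate unit of `A` and `f n` the square root of `E (n + 1) - E n`,
so that `∑ f n * f n = 1 - E 0` strictly. For bounded `y n` in `A` the series `m = ∑ f n * y n * f
n` converges strictly (`DoubleCentralizer.exists_strict_sum`, by Cauchy–Schwarz). Suppose that `f n`
and `y n` commute with a dense sequence of X and are invariant on compact sets up to summable
errors, that `π (f n)` does the same with `z`, and that `π (f n) * (π (y n) - z)` is summably small.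
Then `[m, x]`, `g · m - m` and, up to the term `π (E 0) * z`, `π°(m) - z` are norm-convergent
series, hence lie in `A`, `A` and `B`. Thus `m` solves the problem modulo `A`. Subtracting some `a`
in `A` with `π a = π°(m) - z` makes the lift exact; the commutators and displacements still lie in
`A` and now die in `M(B)`, so they lie in J.

To find `y n` (`CStarAction.exists_approx_lift`), lift `π c * z` to `w`, with `c` quasicentral in
`A`. Commutators and displacements of `w` are small modulo J, and multiplication by `1 - q`, with
`q` quasicentral in J, makes them small in norm.

Quasicentrality comes from a quantitative substitute for Hahn–Banach: means of almost orthogonal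
vectors are small (`exists_mem_convexHull_forall_norm_le`). The bound is uniform over the index set,
so it covers a compact set of group elements at once. -/

/-! ### Averaging and uniformity on compact sets -/

/-- If the `L i (u m)` become orthogonal to each `L i (u n)` uniformly in `i`, then averages of the
`u n` make all `L i` small simultaneously. -/
theorem exists_mem_convexHull_forall_norm_le {V D I : Type*} [AddCommGroup V] [Module ℂ V]
    [NonUnitalNormedRing D] [StarRing D] [CStarRing D] [NormedSpace ℂ D]
    (u : ℕ → V) (L : I → V →ₗ[ℂ] D) (C : ℝ) (hC : ∀ i n, ‖L i (u n)‖ ≤ C)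
    (h : ∀ n, ∀ ε > 0, ∀ᶠ m in atTop, ∀ i, ‖star (L i (u m)) * L i (u n)‖ ≤ ε)
    (k : ℕ) {ε : ℝ} (hε : 0 < ε) :
    ∃ c ∈ convexHull ℝ (u '' Set.Ici k), ∀ i, ‖L i c‖ ≤ ε := by
  -- The squared norm of a mean of `N` terms is at most `C ^ 2 / N + δ`, from diagonal and
  -- off-diagonal pairs; `N > C ^ 2 / δ` bounds it by `2 * δ = ε ^ 2`.
  set δ : ℝ := ε ^ 2 / 2 with hδ
  have hδ0 : 0 < δ := by positivity
  obtain ⟨φ, hφk, hφ⟩ := exists_seq_of_forall_finset_exists (fun n : ℕ => k ≤ n)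
    (fun n m => ∀ i, ‖star (L i (u m)) * L i (u n)‖ ≤ δ) (fun s _ => by
      have := ((Finset.eventually_all s).2 fun n _ => h n δ hδ0).and (eventually_ge_atTop k)
      obtain ⟨m, hm, hk⟩ := this.exists
      exact ⟨m, hk, hm⟩)
  obtain ⟨N, hN⟩ := exists_nat_gt (C ^ 2 / δ)
  have hN0 : (0 : ℝ) < N := lt_of_le_of_lt (by positivity) hN
  refine ⟨∑ j ∈ Finset.range N, ((N : ℝ)⁻¹) • u (φ j), ?_, fun i => ?_⟩
  · refine (convex_convexHull ℝ _).sum_mem (fun _ _ => by positivity) ?_ fun j _ =>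
      subset_convexHull ℝ _ ⟨_, hφk j, rfl⟩
    simp [hN0.ne']
  · set a : ℕ → D := fun j => L i (u (φ j)) with ha
    have hpair : ∀ j l, ‖star (a j) * a l‖ ≤ (if j = l then C ^ 2 else 0) + δ := by
      intro j l
      rcases lt_trichotomy j l with hjl | rfl | hjl
      · have := hφ j l hjl i
        rw [← norm_star, star_mul, star_star] at this
        simpa [hjl.ne] using this
      · have := hC i (φ j)
        rw [CStarRing.norm_star_mul_self, if_pos rfl]
        nlinarith [norm_nonneg (L i (u (φ j)))]
      · simpa [hjl.ne'] using hφ l j hjl i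
    have hsum : ‖∑ j ∈ Finset.range N, a j‖ ^ 2 ≤ N * C ^ 2 + N * (N * δ) := by
      rw [sq, ← CStarRing.norm_star_mul_self, star_sum, Finset.sum_mul_sum]
      calc _ ≤ ∑ j ∈ Finset.range N, ∑ l ∈ Finset.range N, ‖star (a j) * a l‖ :=
            (norm_sum_le _ _).trans (Finset.sum_le_sum fun _ _ => norm_sum_le _ _)
        _ ≤ ∑ j ∈ Finset.range N, ∑ l ∈ Finset.range N, ((if j = l then C ^ 2 else 0) + δ) :=
            Finset.sum_le_sum fun _ _ => Finset.sum_le_sum fun _ _ => hpair _ _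
        _ = ∑ j ∈ Finset.range N, (C ^ 2 + N * δ) := by
            refine Finset.sum_congr rfl fun j hj => ?_
            rw [Finset.sum_add_distrib, Finset.sum_ite_eq, if_pos hj]
            simp
        _ = _ := by simp
    have hL : L i (∑ j ∈ Finset.range N, ((N : ℝ)⁻¹) • u (φ j)) =
        ((N : ℂ)⁻¹) • ∑ j ∈ Finset.range N, a j := by
      rw [← Finset.smul_sum, ← Complex.coe_smul, map_smul, map_sum]
      simp [ha]
    rw [hL, norm_smul, norm_inv, Complex.norm_natCast]
    refine abs_le_of_sq_le_sq' ?_ hε.le |>.2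
    rw [mul_pow, inv_pow, inv_mul_le_iff₀ (by positivity)]
    rw [div_lt_iff₀ hδ0] at hN
    have : ε ^ 2 = 2 * δ := by rw [hδ]; ring
    rw [this]
    nlinarith

theorem IsCompact.eventually_forall_norm_sub_mul_le {A : Type*} [NonUnitalNormedRing A]
    {u : ℕ → A} (hu : ∀ n, ‖u n‖ ≤ 1) {S : Set A} (hS : IsCompact S) {r r' : ℝ} (hr : r < r')
    (h : ∀ a ∈ S, ∀ᶠ n in atTop, ‖a - u n * a‖ ≤ r) :
    ∀ᶠ n in atTop, ∀ a ∈ S, ‖a - u n * a‖ ≤ r' := by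
  -- Replacing `a` by a net point costs at most twice the radius, as `u n` is a contraction.
  obtain ⟨t, htS, htf, hcov⟩ := hS.finite_cover_balls (e := (r' - r) / 2) (by linarith)
  filter_upwards [(htf.eventually_all).2 fun a ha => h a (htS ha)] with n hn a ha
  obtain ⟨x, hx, hax⟩ := Set.mem_iUnion₂.1 (hcov ha)
  rw [Metric.mem_ball, dist_eq_norm] at hax
  have h1 : a - u n * a = (x - u n * x) + ((a - x) - u n * (a - x)) := by noncomm_ring
  have h2 : ‖u n * (a - x)‖ ≤ 1 * ‖a - x‖ := (norm_mul_le _ _).trans (by gcongr; exact hu n)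
  rw [h1]
  have := norm_add_le (x - u n * x) ((a - x) - u n * (a - x))
  have := norm_sub_le (a - x) (u n * (a - x))
  have := hn x hx
  linarith

/-! ### Square roots and Cauchy–Schwarz -/

/-- Hölder continuity of the square root. -/
theorem norm_sub_sq_le_norm_mul_self_sub {D : Type*} [CStarAlgebra D] [PartialOrder D]
    [StarOrderedRing D] {s t : D} (hs : 0 ≤ s) (ht : 0 ≤ t) :
    ‖s - t‖ ^ 2 ≤ ‖s * s - t * t‖ := by
  set δ : ℝ := √‖s * s - t * t‖ with hδ
  -- Operator monotonicity of the square root: `s² ≤ t² + δ² ≤ (t + δ)²` gives `s ≤ t + δ`.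
  have key : ∀ s t : D, 0 ≤ s → 0 ≤ t → ‖s * s - t * t‖ = δ * δ → s - t ≤ algebraMap ℝ D δ := by
    intro s t hs ht hst
    have hsa : IsSelfAdjoint (s * s - t * t) :=
      ((IsSelfAdjoint.of_nonneg hs).mul_self_nonneg.isSelfAdjoint).sub
        ((IsSelfAdjoint.of_nonneg ht).mul_self_nonneg.isSelfAdjoint)
    have h1 : s * s - t * t ≤ algebraMap ℝ D (δ * δ) := hst ▸ hsa.le_algebraMap_norm_self
    have h0 : (0 : D) ≤ algebraMap ℝ D δ := algebraMap_nonneg D (Real.sqrt_nonneg _)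
    have h2 : s * s ≤ (t + algebraMap ℝ D δ) * (t + algebraMap ℝ D δ) := by
      have e : (t + algebraMap ℝ D δ) * (t + algebraMap ℝ D δ) =
          t * t + algebraMap ℝ D (δ * δ) + (2 * δ) • t := by
        simp only [Algebra.algebraMap_eq_smul_one, mul_add, add_mul, smul_mul_assoc, mul_smul_comm,
          one_mul, mul_one, smul_smul, smul_add, two_mul, add_smul]
        abel
      rw [e]
      have : 0 ≤ (2 * δ) • t := smul_nonneg (by positivity) ht
      calc s * s ≤ t * t + algebraMap ℝ D (δ * δ) := by rwa [← sub_le_iff_le_add']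
        _ ≤ _ := le_add_of_nonneg_right this
    have h3 := CFC.sqrt_le_sqrt _ _ h2
    rw [CFC.sqrt_mul_self s, CFC.sqrt_mul_self _ (add_nonneg ht h0)] at h3
    rwa [sub_le_iff_le_add']
  have hδδ : δ * δ = ‖s * s - t * t‖ := Real.mul_self_sqrt (norm_nonneg _)
  have hsa : IsSelfAdjoint (s - t) := hs.isSelfAdjoint.sub ht.isSelfAdjoint
  have h1 := key s t hs ht hδδ.symm
  have h2 := key t s ht hs (by rw [norm_sub_rev, hδδ])
  have : ‖s - t‖ ≤ δ := by
    rcases subsingleton_or_nontrivial D with hD | hD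
    · rw [Subsingleton.elim (s - t) 0, norm_zero]
      exact Real.sqrt_nonneg _
    rcases CStarAlgebra.norm_or_neg_norm_mem_spectrum hsa with h | h
    · exact (le_algebraMap_iff_spectrum_le hsa).1 h1 _ h
    · have := (algebraMap_le_iff_le_spectrum hsa (r := -δ)).1
        (by rw [map_neg, neg_le, neg_sub]; exact h2) _ h
      linarith
  rw [← hδδ, sq]
  gcongr

/-- For unitary `u` the commutator has the norm of `f - u f u*`, and conjugation by `u` respects
squares, so the square root estimate applies to `f` and `u f u*`. -/
theorem norm_mul_sub_mul_sq_le {D : Type*} [CStarAlgebra D] [PartialOrder D]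
    [StarOrderedRing D] {f u : D} (hf : 0 ≤ f) (hu : u ∈ unitary D) :
    ‖f * u - u * f‖ ^ 2 ≤ ‖(f * f) * u - u * (f * f)‖ := by
  have e : ∀ a : D, ‖a * u - u * a‖ = ‖a - u * a * star u‖ := fun a => by
    rw [← CStarRing.norm_mul_mem_unitary (a - u * a * star u) hu]
    rw [sub_mul, mul_assoc _ (star u), Unitary.star_mul_self_of_mem hu, mul_one]
  have e2 : u * (f * f) * star u = (u * f * star u) * (u * f * star u) := by
    simp only [mul_assoc]
    rw [← mul_assoc (star u) u, Unitary.star_mul_self_of_mem hu, one_mul]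
  rw [e, e, e2]
  exact norm_sub_sq_le_norm_mul_self_sub hf (star_right_conjugate_nonneg hf u)

/-- The Cauchy–Schwarz inequality for finite sums in a C⋆-algebra. -/
theorem norm_sum_star_mul_sq_le {D : Type*} [NonUnitalCStarAlgebra D] [PartialOrder D]
    [StarOrderedRing D] (s : Finset ℕ) (a b : ℕ → D) :
    ‖∑ n ∈ s, a n * b n‖ ^ 2 ≤ ‖∑ n ∈ s, a n * star (a n)‖ * ‖∑ n ∈ s, star (b n) * b n‖ := by
  let x : WithCStarModule D (s → D) := (WithCStarModule.equiv D (s → D)).symm fun n => star (b n)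
  let y : WithCStarModule D (s → D) := (WithCStarModule.equiv D (s → D)).symm fun n => a n
  have h := CStarModule.norm_inner_le (A := D) (x := x) (y := y)
  have h2 : ‖inner D x y‖ ^ 2 ≤ ‖x‖ ^ 2 * ‖y‖ ^ 2 := by
    rw [← mul_pow]
    gcongr
  rw [WithCStarModule.pi_norm_sq, WithCStarModule.pi_norm_sq, WithCStarModule.pi_inner] at h2
  simp only [x, y, WithCStarModule.equiv_symm_pi_apply, WithCStarModule.inner_def, star_star,
    Finset.sum_coe_sort s (fun n => a n * b n), Finset.sum_coe_sort s (fun n => star (b n) * b n),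
    Finset.sum_coe_sort s (fun n => a n * star (a n))] at h2
  rwa [mul_comm]

/-- The embedding of a C⋆-algebra into its multiplier algebra. -/
local notation "ȷ" => DoubleCentralizer.coeHom (𝕜 := ℂ)

/-! ### Multipliers and their commutators -/

section Multiplier

variable {A B : Type*} [NonUnitalCStarAlgebra A] [NonUnitalCStarAlgebra B]

theorem DoubleCentralizer.norm_coeHom (a : A) : ‖ȷ a‖ = ‖a‖ := by
  rw [← DoubleCentralizer.norm_fst]
  exact ContinuousLinearMap.opNorm_mul_apply ℂ A a

theorem DoubleCentralizer.isometry_coeHom : Isometry (ȷ : A → 𝓜(ℂ, A)) :=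
  AddMonoidHomClass.isometry_of_norm (DoubleCentralizer.coeHom (𝕜 := ℂ) (A := A))
    DoubleCentralizer.norm_coeHom

theorem DoubleCentralizer.isClosed_range_coeHom : IsClosed (Set.range (ȷ : A → 𝓜(ℂ, A))) :=
  DoubleCentralizer.isometry_coeHom.isClosedEmbedding.isClosed_range

/-- The norm of a multiplier is that of its left action, so identities need checking on one side
only. -/
theorem DoubleCentralizer.ext_of_fst {m n : 𝓜(ℂ, A)} (h : ∀ a, m.fst a = n.fst a) : m = n := by
  rw [← sub_eq_zero, ← norm_eq_zero, ← DoubleCentralizer.norm_fst, norm_eq_zero]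
  ext a
  simp [h a]

/-- By centrality every `c` annihilates the difference from the left; take `c` to be its adjoint. -/
theorem DoubleCentralizer.fst_mul (m : 𝓜(ℂ, A)) (a b : A) : m.fst (a * b) = m.fst a * b := by
  have h : ∀ c : A, c * (m.fst (a * b) - m.fst a * b) = 0 := fun c => by
    rw [mul_sub, ← mul_assoc, ← m.central, ← m.central, mul_assoc, sub_self]
  rw [← sub_eq_zero, ← CStarRing.star_mul_self_eq_zero_iff]
  exact h _

theorem DoubleCentralizer.mul_coeHom (m : 𝓜(ℂ, A)) (a : A) : m * ȷ a = ȷ (m.fst a) :=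
  DoubleCentralizer.ext_of_fst fun b => by simp [DoubleCentralizer.fst_mul]

theorem DoubleCentralizer.coeHom_mul (m : 𝓜(ℂ, A)) (a : A) : ȷ a * m = ȷ (m.snd a) :=
  DoubleCentralizer.ext_of_fst fun b => by simp [m.central]

theorem multiplierMap_coeHom (φ : A →⋆ₙₐ[ℂ] B) (hφ : Function.Surjective φ) (a : A) :
    multiplierMap φ hφ (ȷ a) = ȷ (φ a) :=
  DoubleCentralizer.ext_of_fst fun b => by
    obtain ⟨b, rfl⟩ := hφ b
    simp [multiplierMap_fst]

/-- The map `a ↦ [a, m]` from `A` to `M(A)`. -/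
noncomputable def DoubleCentralizer.commutator (m : 𝓜(ℂ, A)) : A →ₗ[ℂ] 𝓜(ℂ, A) where
  toFun a := ȷ a * m - m * ȷ a
  map_add' a b := by rw [map_add]; noncomm_ring
  map_smul' r a := by simp [smul_sub]

theorem DoubleCentralizer.commutator_apply (m : 𝓜(ℂ, A)) (a : A) :
    m.commutator a = ȷ a * m - m * ȷ a := rfl

theorem DoubleCentralizer.commutator_eq_coeHom (m : 𝓜(ℂ, A)) (a : A) :
    m.commutator a = ȷ (m.snd a - m.fst a) := by
  rw [commutator_apply, coeHom_mul, mul_coeHom, map_sub]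

theorem DoubleCentralizer.norm_commutator_le (m : 𝓜(ℂ, A)) (a : A) :
    ‖m.commutator a‖ ≤ 2 * ‖m‖ * ‖a‖ := by
  have h1 := norm_mul_le (ȷ a) m
  have h2 := norm_mul_le m (ȷ a)
  rw [norm_coeHom] at h1 h2
  have h3 := norm_sub_le (ȷ a * m) (m * ȷ a)
  rw [commutator_apply]
  linarith [mul_comm ‖m‖ ‖a‖]

/-- `[u n, m]* d = m* (u n d) - u n (m* d)`, and both terms tend to `m* d`. This supplies the
asymptotic orthogonality for the averaging lemma. -/
theorem DoubleCentralizer.tendsto_star_commutator_mul {u : ℕ → A} (m : 𝓜(ℂ, A)) (d : A)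
    (hu : ∀ n, IsSelfAdjoint (u n)) (h : Tendsto (fun n => u n * d) atTop (𝓝 d))
    (h' : Tendsto (fun n => u n * (star m).fst d) atTop (𝓝 ((star m).fst d))) :
    Tendsto (fun n => star (m.commutator (u n)) * ȷ d) atTop (𝓝 0) := by
  have hc : Continuous (ȷ : A → 𝓜(ℂ, A)) := isometry_coeHom.continuous
  have := (((hc.tendsto _).comp h).const_mul (star m)).sub ((hc.tendsto _).comp h')
  rw [mul_coeHom, sub_self] at this
  refine this.congr fun n => ?_
  simp only [Function.comp_apply, commutator_apply, star_sub, star_mul, map_mul]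
  rw [← map_star, (hu n).star_eq, ← mul_coeHom]
  noncomm_ring

variable {G : Type*} [Group G] [TopologicalSpace G]

theorem CStarAction.onMultiplier_coeHom (α : CStarAction G A) (g : G) (a : A) :
    α.onMultiplier g (ȷ a) = ȷ (α.aut g a) :=
  multiplierMap_coeHom _ _ a

theorem CStarAction.onMultiplier_fst (α : CStarAction G A) (g : G) (m : 𝓜(ℂ, A)) (a : A) :
    (α.onMultiplier g m).fst (α.aut g a) = α.aut g (m.fst a) :=
  multiplierMap_fst _ _ m a

theorem CStarAction.norm_aut (α : CStarAction G A) (g : G) (a : A) : ‖α.aut g a‖ = ‖a‖ :=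
  NonUnitalStarAlgHom.norm_map (α.aut g) (EquivLike.injective (α.aut g)) a

theorem CStarAction.aut_aut_inv (α : CStarAction G A) (g : G) (a : A) :
    α.aut g (α.aut g⁻¹ a) = a := by
  rw [← StarAlgEquiv.mul_apply, ← map_mul, mul_inv_cancel, map_one, StarAlgEquiv.one_apply]

end Multiplier

/-! ### Quasicentral convex combinations -/

section Quasicentral

variable {G A B : Type*} [Group G] [TopologicalSpace G] [IsTopologicalGroup G]
  [NonUnitalCStarAlgebra A] [NonUnitalCStarAlgebra B]

/-- An approximate unit of an invariant ideal has convex combinations, arbitrarily far out, that are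
quasicentral for finitely many multipliers and almost invariant on a compact set. -/
theorem CStarAction.exists_quasicentral_mem_convexHull (α : CStarAction G A) (φ : A →⋆ₙₐ[ℂ] B)
    (I : Submodule ℂ A) (hfst : ∀ m : 𝓜(ℂ, A), ∀ a ∈ I, m.fst a ∈ I)
    (hsnd : ∀ m : 𝓜(ℂ, A), ∀ a ∈ I, m.snd a ∈ I) (hG : ∀ g, ∀ a ∈ I, α.aut g a ∈ I)
    {u : ℕ → A} (husa : ∀ n, IsSelfAdjoint (u n)) (hu₁ : ∀ n, ‖u n‖ ≤ 1) (huI : ∀ n, u n ∈ I)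
    (hu : ∀ a ∈ I, Tendsto (fun n => u n * a) atTop (𝓝 a))
    (F : Finset 𝓜(ℂ, A)) (T : Finset 𝓜(ℂ, B))
    (hT : T.Nonempty → ∀ b : B, Tendsto (fun n => φ (u n) * b) atTop (𝓝 b))
    {K : Set G} (hK : IsCompact K) (k : ℕ) {ε : ℝ} (hε : 0 < ε) :
    ∃ c ∈ convexHull ℝ (u '' Set.Ici k), (∀ m ∈ F, ‖ȷ c * m - m * ȷ c‖ ≤ ε) ∧
      (∀ v ∈ T, ‖ȷ (φ c) * v - v * ȷ (φ c)‖ ≤ ε) ∧ ∀ g ∈ K, ‖α.aut g c - c‖ ≤ ε := by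
  let diff (g : G) : A →ₗ[ℂ] 𝓜(ℂ, A) :=
    { toFun := fun a => ȷ (α.aut g a - a)
      map_add' := fun a b => by rw [← map_add, map_add (α.aut g)]; congr 1; abel
      map_smul' := fun r a => by rw [map_smul, ← smul_sub, map_smul]; rfl }
  -- All errors become linear maps into one C⋆-algebra, so a single average treats them together.
  let L : F ⊕ T ⊕ K → A →ₗ[ℂ] 𝓜(ℂ, A) × 𝓜(ℂ, B) := Sum.elim
    (fun m => LinearMap.inl ℂ _ _ ∘ₗ m.1.commutator) (Sum.elim
    (fun v => LinearMap.inr ℂ _ _ ∘ₗ v.1.commutator ∘ₗ (φ : A →ₗ[ℂ] B))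
    (fun g => LinearMap.inl ℂ _ _ ∘ₗ diff g.1))
  have hC : ∀ i n, ‖L i (u n)‖ ≤ 2 * ∑ m ∈ F, ‖m‖ + 2 * ∑ v ∈ T, ‖v‖ + 2 := by
    have hF0 : 0 ≤ ∑ m ∈ F, ‖m‖ := by positivity
    have hT0 : 0 ≤ ∑ v ∈ T, ‖v‖ := by positivity
    rintro (⟨m, hm⟩ | ⟨v, hv⟩ | ⟨g, hg⟩) n
    · have h1 : ‖m‖ ≤ ∑ m ∈ F, ‖m‖ := Finset.single_le_sum (f := norm) (fun _ _ => norm_nonneg _) hm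
      have h2 := m.norm_commutator_le (u n)
      simp only [L, Sum.elim_inl, LinearMap.comp_apply, LinearMap.inl_apply, Prod.norm_mk, norm_zero,
        norm_nonneg, sup_of_le_left]
      nlinarith [hu₁ n, norm_nonneg m]
    · have h1 : ‖v‖ ≤ ∑ v ∈ T, ‖v‖ := Finset.single_le_sum (f := norm) (fun _ _ => norm_nonneg _) hv
      have h2 := v.norm_commutator_le (φ (u n))
      have h3 := NonUnitalStarAlgHom.norm_apply_le φ (u n)
      simp only [L, Sum.elim_inr, Sum.elim_inl, LinearMap.comp_apply, LinearMap.inr_apply,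
        Prod.norm_mk, norm_zero, norm_nonneg, sup_of_le_right]
      change ‖v.commutator (φ (u n))‖ ≤ _
      nlinarith [hu₁ n, norm_nonneg v]
    · have h2 := norm_sub_le (α.aut g (u n)) (u n)
      rw [α.norm_aut] at h2
      simp only [L, Sum.elim_inr, LinearMap.comp_apply, LinearMap.inl_apply, Prod.norm_mk,
        norm_zero, norm_nonneg, sup_of_le_left]
      change ‖ȷ (α.aut g (u n) - u n)‖ ≤ _
      rw [DoubleCentralizer.norm_coeHom]
      linarith [hu₁ n]
  have hlim : ∀ n, ∀ ε > 0, ∀ᶠ m in atTop, ∀ i, ‖star (L i (u m)) * L i (u n)‖ ≤ ε := by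
    intro n δ hδ
    have h1 : ∀ m ∈ F, ∀ᶠ p in atTop, ‖star (m.commutator (u p)) * m.commutator (u n)‖ ≤ δ := by
      intro m _
      have hmem : m.snd (u n) - m.fst (u n) ∈ I := I.sub_mem (hsnd _ _ (huI n)) (hfst _ _ (huI n))
      have := (DoubleCentralizer.tendsto_star_commutator_mul m _ husa (hu _ hmem)
        (hu _ (hfst _ _ hmem))).norm
      rw [norm_zero] at this
      simpa only [← DoubleCentralizer.commutator_eq_coeHom] using this.eventually_le_const hδ
    have h2 : ∀ v ∈ T, ∀ᶠ p in atTop,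
        ‖star (v.commutator (φ (u p))) * v.commutator (φ (u n))‖ ≤ δ := by
      intro v hv
      have := (DoubleCentralizer.tendsto_star_commutator_mul v
        (v.snd (φ (u n)) - v.fst (φ (u n))) (fun p => (husa p).map φ) (hT ⟨v, hv⟩ _)
        (hT ⟨v, hv⟩ _)).norm
      rw [norm_zero] at this
      simpa only [← DoubleCentralizer.commutator_eq_coeHom] using this.eventually_le_const hδ
    -- With `d = g u_n - u_n`, the product is `(d - u_p d) - (d - (g u_p) d)`, and the second
    -- bracket is the `g`-translate of `d' - u_p d'` for `d' = g⁻¹ d`. Both `d` and `d'` range over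
    -- compact sets.
    have h3 : ∀ᶠ p in atTop, ∀ g ∈ K,
        ‖star (α.aut g (u p) - u p) * (α.aut g (u n) - u n)‖ ≤ δ := by
      have hS₁ : IsCompact ((fun g => α.aut g (u n) - u n) '' K) :=
        hK.image ((α.continuous_apply _).sub continuous_const)
      have hS₂ : IsCompact ((fun g => u n - α.aut g⁻¹ (u n)) '' K) :=
        hK.image (continuous_const.sub ((α.continuous_apply _).comp continuous_inv))
      have hunif : ∀ S : Set A, IsCompact S → S ⊆ I →
          ∀ᶠ p in atTop, ∀ a ∈ S, ‖a - u p * a‖ ≤ δ / 2 := fun S hS hSI =>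
        hS.eventually_forall_norm_sub_mul_le hu₁ (r := δ / 4) (by linarith) fun a ha => by
          have := ((hu a (hSI ha)).const_sub a).norm
          rw [sub_self, norm_zero] at this
          exact this.eventually_le_const (by positivity)
      filter_upwards [hunif _ hS₁ (by
          rintro _ ⟨g, _, rfl⟩; exact I.sub_mem (hG _ _ (huI n)) (huI n)), hunif _ hS₂ (by
          rintro _ ⟨g, _, rfl⟩; exact I.sub_mem (huI n) (hG _ _ (huI n)))] with p hp₁ hp₂ g hg
      have e₁ := hp₁ _ ⟨g, hg, rfl⟩
      have e₂ := hp₂ _ ⟨g, hg, rfl⟩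
      simp only at e₁ e₂
      rw [← α.norm_aut g, map_sub, map_mul, map_sub, α.aut_aut_inv] at e₂
      rw [star_sub, ← map_star, (husa p).star_eq]
      have e : (α.aut g (u p) - u p) * (α.aut g (u n) - u n) =
          (α.aut g (u n) - u n - u p * (α.aut g (u n) - u n)) -
          (α.aut g (u n) - u n - α.aut g (u p) * (α.aut g (u n) - u n)) := by noncomm_ring
      rw [e]
      exact (norm_sub_le _ _).trans (by linarith)
    filter_upwards [(Finset.eventually_all F).2 h1, (Finset.eventually_all T).2 h2, h3]
      with p hp₁ hp₂ hp₃
    rintro (⟨m, hm⟩ | ⟨v, hv⟩ | ⟨g, hg⟩)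
    · simpa [L, Prod.star_def] using hp₁ m hm
    · simpa [L, Prod.star_def] using hp₂ v hv
    · have := hp₃ g hg
      rw [← DoubleCentralizer.norm_coeHom, map_mul, map_star] at this
      simpa [L, diff, Prod.star_def] using this
  obtain ⟨c, hc, hL⟩ := exists_mem_convexHull_forall_norm_le u L
    (2 * ∑ m ∈ F, ‖m‖ + 2 * ∑ v ∈ T, ‖v‖ + 2) hC hlim k hε
  refine ⟨c, hc, fun m hm => ?_, fun v hv => ?_, fun g hg => ?_⟩
  · simpa [L, DoubleCentralizer.commutator_apply] using hL (.inl ⟨m, hm⟩)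
  · simpa [L, DoubleCentralizer.commutator_apply] using hL (.inr (.inl ⟨v, hv⟩))
  · rw [← DoubleCentralizer.norm_coeHom]
    simpa [L, diff] using hL (.inr (.inr ⟨g, hg⟩))

end Quasicentral

/-! ### Properties inherited by convex combinations -/

section ConvexHull

variable {A : Type*} [NonUnitalCStarAlgebra A] {s : Set A} {c : A}

theorem norm_le_of_mem_convexHull {r : ℝ} (hs : ∀ a ∈ s, ‖a‖ ≤ r) (hc : c ∈ convexHull ℝ s) :
    ‖c‖ ≤ r :=
  mem_closedBall_zero_iff.1 <| convexHull_min (fun a ha => mem_closedBall_zero_iff.2 (hs a ha))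
    (convex_closedBall 0 r) hc

theorem norm_sub_mul_le_of_mem_convexHull {r : ℝ} {a : A} (hs : ∀ b ∈ s, ‖a - b * a‖ ≤ r)
    (hc : c ∈ convexHull ℝ s) : ‖a - c * a‖ ≤ r := by
  have hconv : Convex ℝ (LinearMap.mulRight ℝ a ⁻¹' Metric.closedBall a r) :=
    (convex_closedBall a r).linear_preimage _
  have := convexHull_min (fun b hb => ?_) hconv hc
  · rwa [Set.mem_preimage, LinearMap.mulRight_apply, mem_closedBall_iff_norm'] at this
  · rw [Set.mem_preimage, LinearMap.mulRight_apply, mem_closedBall_iff_norm']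
    exact hs b hb

theorem mem_of_mem_convexHull {I : Submodule ℂ A} (hs : s ⊆ I) (hc : c ∈ convexHull ℝ s) : c ∈ I :=
  convexHull_min hs (I.restrictScalars ℝ).convex hc

theorem isSelfAdjoint_of_mem_convexHull (hs : ∀ a ∈ s, IsSelfAdjoint a)
    (hc : c ∈ convexHull ℝ s) : IsSelfAdjoint c :=
  convexHull_min (s := s) (t := selfAdjoint.submodule ℝ A) hs (selfAdjoint.submodule ℝ A).convex hc

variable [PartialOrder A] [StarOrderedRing A]

theorem Monotone.le_of_mem_convexHull {e : ℕ → A} (he : Monotone e) {k : ℕ}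
    (hc : c ∈ convexHull ℝ (e '' Set.Ici k)) : e k ≤ c :=
  convexHull_min (t := Set.Ici (e k)) (by rintro _ ⟨n, hn, rfl⟩; exact he hn) (convex_Ici _) hc

theorem Monotone.exists_ge_of_mem_convexHull {e : ℕ → A} (he : Monotone e) {t : Set ℕ}
    (hc : c ∈ convexHull ℝ (e '' t)) : ∃ n, c ≤ e n := by
  refine convexHull_min (t := {c | ∃ n, c ≤ e n}) ?_ ?_ hc
  · rintro _ ⟨n, _, rfl⟩
    exact ⟨n, le_rfl⟩
  · rintro x ⟨n, hn⟩ y ⟨m, hm⟩ p q hp hq hpq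
    exact ⟨max n m, convex_Iic (𝕜 := ℝ) (e (max n m)) (hn.trans (he (le_max_left _ _)))
      (hm.trans (he (le_max_right _ _))) hp hq hpq⟩

end ConvexHull

/-! ### Quasicentral approximate units and approximate lifts -/

section QuasicentralSequence

variable {G A B : Type*} [Group G] [TopologicalSpace G] [IsTopologicalGroup G]
  [NonUnitalCStarAlgebra A] [NonUnitalCStarAlgebra B]

/-- A sequential increasing approximate unit that is quasicentral and asymptotically invariant. -/
theorem CStarAction.exists_monotone_quasicentral [PartialOrder A] [StarOrderedRing A]
    (α : CStarAction G A) (φ : A →⋆ₙₐ[ℂ] B) (hφ : Function.Surjective φ) {e : ℕ → A}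
    (he : Monotone e) (he₀ : ∀ n, 0 ≤ e n) (he₁ : ∀ n, ‖e n‖ ≤ 1)
    (hlim : ∀ a, Tendsto (fun n => e n * a) atTop (𝓝 a))
    (F : ℕ → Finset 𝓜(ℂ, A)) (T : ℕ → Finset 𝓜(ℂ, B)) {K : ℕ → Set G} (hK : ∀ n, IsCompact (K n))
    {ε : ℕ → ℝ} (hε : ∀ n, 0 < ε n) :
    ∃ E : ℕ → A, Monotone E ∧ (∀ n, 0 ≤ E n) ∧ (∀ n, ‖E n‖ ≤ 1) ∧
      (∀ a, Tendsto (fun n => E n * a) atTop (𝓝 a)) ∧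
      (∀ n, ∀ m ∈ F n, ‖ȷ (E n) * m - m * ȷ (E n)‖ ≤ ε n) ∧
      (∀ n, ∀ v ∈ T n, ‖ȷ (φ (E n)) * v - v * ȷ (φ (E n))‖ ≤ ε n) ∧
      ∀ n, ∀ g ∈ K n, ‖α.aut g (E n) - E n‖ ≤ ε n := by
  have hcont : Continuous φ := map_continuous φ
  have hlimB : ∀ b, Tendsto (fun n => φ (e n) * b) atTop (𝓝 b) := fun b => by
    obtain ⟨a, rfl⟩ := hφ b
    simpa [Function.comp_def] using (hcont.tendsto a).comp (hlim a)
  choose c hc hcF hcT hcK using fun n k => α.exists_quasicentral_mem_convexHull φ ⊤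
    (fun _ _ _ => trivial) (fun _ _ _ => trivial) (fun _ _ _ => trivial)
    (fun n => (he₀ n).isSelfAdjoint) he₁ (fun _ => trivial) (fun a _ => hlim a) (F n) (T n)
    (fun _ => hlimB) (hK n) k (hε n)
  choose top htop using fun n k => he.exists_ge_of_mem_convexHull (hc n k)
  -- Each combination starts beyond an `e`-term dominating its predecessor, which gives
  -- monotonicity; the `n + 1` forces `k n → ∞`.
  let k : ℕ → ℕ := Nat.rec 0 fun n k => max (top n k) (n + 1)
  have hk : ∀ n, n ≤ k n := fun n => by
    cases n with
    | zero => exact Nat.zero_le _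
    | succ n => exact le_max_right _ _
  refine ⟨fun n => c n (k n), monotone_nat_of_le_succ fun n => ?_, fun n => ?_, fun n => ?_,
    fun a => ?_, fun n => hcF n _, fun n => hcT n _, fun n => hcK n _⟩
  · exact (htop n (k n)).trans ((he (le_max_left _ _)).trans (he.le_of_mem_convexHull (hc _ _)))
  · exact (he₀ _).trans (he.le_of_mem_convexHull (hc _ _))
  · exact norm_le_of_mem_convexHull (by rintro _ ⟨n, _, rfl⟩; exact he₁ n) (hc n (k n))
  · rw [Metric.tendsto_atTop]
    intro δ hδ
    obtain ⟨N, hN⟩ := Metric.tendsto_atTop.1 (hlim a) (δ / 2) (by linarith)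
    refine ⟨N, fun n hn => ?_⟩
    rw [dist_comm, dist_eq_norm]
    refine (norm_sub_mul_le_of_mem_convexHull (r := δ / 2) ?_ (hc n (k n))).trans_lt (by linarith)
    rintro _ ⟨m, hm, rfl⟩
    rw [← dist_eq_norm, dist_comm]
    exact (hN m ((hn.trans (hk n)).trans hm)).le

/-- An invariant multiplier `z` of the quotient is approximated on `π f` by the image of a bounded
element of `A` that is almost invariant and almost commutes with finitely many multipliers. -/
theorem CStarAction.exists_approx_lift (α : CStarAction G A) (β : CStarAction G B)
    (π : A →⋆ₙₐ[ℂ] B) (hπ : Function.Surjective π) (hG : ∀ g a, π (α.aut g a) = β.aut g (π a))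
    {e j : ℕ → A} (hesa : ∀ n, IsSelfAdjoint (e n)) (he₁ : ∀ n, ‖e n‖ ≤ 1)
    (he : ∀ a, Tendsto (fun n => e n * a) atTop (𝓝 a))
    (hjsa : ∀ n, IsSelfAdjoint (j n)) (hj₁ : ∀ n, ‖j n‖ ≤ 1) (hjπ : ∀ n, π (j n) = 0)
    (hj : ∀ a, π a = 0 → Tendsto (fun n => j n * a) atTop (𝓝 a))
    (z : 𝓜(ℂ, B)) (hz : ∀ g, β.onMultiplier g z = z) :
    ∃ R, ∀ (f : A) (F : Finset 𝓜(ℂ, A)) (K : Set G) (ε : ℝ), IsCompact K → 0 < ε →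
      (∀ x ∈ F, multiplierMap π hπ x * z = z * multiplierMap π hπ x) →
      ∃ y : A, ‖y‖ ≤ R ∧ (∀ x ∈ F, ‖ȷ y * x - x * ȷ y‖ ≤ ε) ∧
        (∀ g ∈ K, ‖α.aut g y - y‖ ≤ ε) ∧ ‖ȷ (π f) * (ȷ (π y) - z)‖ ≤ ε := by
  have hcont : Continuous π := map_continuous π
  have hbd : ∀ a, ‖π a‖ ≤ ‖a‖ := NonUnitalStarAlgHom.norm_apply_le π
  obtain ⟨C, hC0, hC⟩ := ContinuousLinearMap.exists_preimage_norm_le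
    (⟨(π : A →ₗ[ℂ] B), hcont⟩ : A →L[ℂ] B) hπ
  replace hC : ∀ b, ∃ a, π a = b ∧ ‖a‖ ≤ C * ‖b‖ := hC
  set Z := ‖z‖ with hZ
  have hZ0 : 0 ≤ Z := norm_nonneg z
  -- `C` is the open mapping constant of `π`. The bound on `‖(1 - q) w‖` must not depend on `f` or
  -- `ε`, as strict summability needs bounded `y n`.
  refine ⟨2 * (C * Z), fun f F K ε hK hε hF => ?_⟩
  obtain ⟨δ, hδ0, hδ⟩ : ∃ δ > 0, δ * (3 * (C * Z) + 1 + Z) = ε :=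
    ⟨ε / (3 * (C * Z) + 1 + Z), by positivity, by field_simp⟩
  have hCZ : 0 ≤ C * Z := by positivity
  obtain ⟨k, hk⟩ := Metric.tendsto_atTop.1 (he (star f)) δ hδ0
  obtain ⟨c, hc, hcF, -, hcK⟩ := α.exists_quasicentral_mem_convexHull π ⊤
    (fun _ _ _ => trivial) (fun _ _ _ => trivial) (fun _ _ _ => trivial)
    hesa he₁ (fun _ => trivial) (fun a _ => he a) F ∅ (by simp) hK k hδ0
  have hc₁ : ‖c‖ ≤ 1 := norm_le_of_mem_convexHull (by rintro _ ⟨n, _, rfl⟩; exact he₁ n) hc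
  have hcsa : IsSelfAdjoint c :=
    isSelfAdjoint_of_mem_convexHull (by rintro _ ⟨n, _, rfl⟩; exact hesa n) hc
  have hcf : ‖f - f * c‖ ≤ δ := by
    have := norm_sub_mul_le_of_mem_convexHull (r := δ) (a := star f) (by
      rintro _ ⟨n, hn, rfl⟩
      rw [← dist_eq_norm, dist_comm]
      exact (hk n hn).le) hc
    rwa [← norm_star, star_sub, star_mul, star_star, hcsa.star_eq] at this
  -- Since `z` is invariant and commutes with the images of `F`, `π [w, x] = [π c, π x] z`, and
  -- likewise for displacements: both are small because `c` is quasicentral.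
  obtain ⟨w, hw, hwC⟩ := hC (z.snd (π c))
  have hw' : ȷ (π w) = ȷ (π c) * z := by rw [hw, DoubleCentralizer.coeHom_mul]
  have hw₁ : ‖w‖ ≤ C * Z := by
    refine hwC.trans (mul_le_mul_of_nonneg_left ?_ hC0.le)
    calc ‖z.snd (π c)‖ ≤ ‖z.snd‖ * ‖π c‖ := z.snd.le_opNorm _
      _ ≤ Z * 1 := by
        rw [DoubleCentralizer.norm_snd]
        gcongr
        exact (hbd c).trans hc₁
      _ = Z := mul_one Z
  have hsmallF : ∀ x ∈ F, ‖π (x.snd w - x.fst w)‖ ≤ δ * Z := fun x hx => by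
    have e : ȷ (π (x.snd w - x.fst w)) = multiplierMap π hπ (ȷ c * x - x * ȷ c) * z := by
      rw [← multiplierMap_coeHom π hπ, map_sub, ← DoubleCentralizer.mul_coeHom,
        ← DoubleCentralizer.coeHom_mul]
      simp only [map_sub, map_mul, multiplierMap_coeHom]
      rw [hw', mul_assoc, ← hF x hx]
      noncomm_ring
    rw [← DoubleCentralizer.norm_coeHom, e]
    refine (norm_mul_le _ _).trans (mul_le_mul_of_nonneg_right ?_ hZ0)
    exact (NonUnitalStarAlgHom.norm_apply_le (multiplierMap π hπ) _).trans (hcF x hx)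
  have hsmallG : ∀ g ∈ K, ‖π (α.aut g w - w)‖ ≤ δ * Z := fun g hg => by
    have e : ȷ (π (α.aut g w - w)) = ȷ (π (α.aut g c - c)) * z := by
      simp only [map_sub, hG]
      rw [← β.onMultiplier_coeHom, hw', map_mul, hz, β.onMultiplier_coeHom, sub_mul]
    rw [← DoubleCentralizer.norm_coeHom, e]
    refine (norm_mul_le _ _).trans (mul_le_mul_of_nonneg_right ?_ hZ0)
    rw [DoubleCentralizer.norm_coeHom]
    exact (hbd _).trans (hcK g hg)
  set S : Set A := (fun x : 𝓜(ℂ, A) => x.snd w - x.fst w) '' F ∪ (fun g => α.aut g w - w) '' K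
  have hS : IsCompact S := (F.finite_toSet.image _).isCompact.union
    (hK.image ((α.continuous_apply w).sub continuous_const))
  have hSsmall : ∀ a ∈ S, ‖π a‖ ≤ δ * Z := by
    rintro _ (⟨x, hx, rfl⟩ | ⟨g, hg, rfl⟩)
    · exact hsmallF x hx
    · exact hsmallG g hg
  -- Split `a` into a short lift `a'` of `π a`, of norm at most `C * (δ * Z)`, and a kernel element
  -- on which `j n` acts as an approximate unit.
  have hSj : ∀ᶠ n in atTop, ∀ a ∈ S, ‖a - j n * a‖ ≤ δ * (2 * (C * Z) + 1) := by
    refine hS.eventually_forall_norm_sub_mul_le hj₁ (r := δ * (2 * (C * Z) + 1 / 2)) (by nlinarith)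
      fun a ha => ?_
    obtain ⟨a', ha', ha'C⟩ := hC (π a)
    have hker : π (a - a') = 0 := by rw [map_sub, ha', sub_self]
    have := ((hj _ hker).const_sub (a - a')).norm
    rw [sub_self, norm_zero] at this
    filter_upwards [this.eventually_le_const (show 0 < δ / 2 by positivity)] with n hn
    have e : a - j n * a = (a' - j n * a') + (a - a' - j n * (a - a')) := by noncomm_ring
    have h1 : ‖a'‖ ≤ C * (δ * Z) := ha'C.trans (by gcongr; exact hSsmall a ha)
    have h2 : ‖j n * a'‖ ≤ 1 * ‖a'‖ := (norm_mul_le _ _).trans (by gcongr; exact hj₁ n)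
    rw [e]
    have := norm_add_le (a' - j n * a') (a - a' - j n * (a - a'))
    have := norm_sub_le a' (j n * a')
    nlinarith
  obtain ⟨l, hl⟩ := eventually_atTop.1 hSj
  -- No multipliers of `B` are imposed here: `π` kills every `j n`, so their images need not form an
  -- approximate unit of `B`.
  obtain ⟨q, hq, hqF, -, hqK⟩ := α.exists_quasicentral_mem_convexHull π
    (LinearMap.ker (π : A →ₗ[ℂ] B)) (fun m a ha => m.map_fst_eq_zero π a ha)
    (fun m a ha => m.map_snd_eq_zero π a ha)
    (fun g a ha => by
      change π (α.aut g a) = 0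
      rw [hG, show π a = 0 from ha, map_zero])
    hjsa hj₁ hjπ hj F ∅ (by simp) hK l hδ0
  have hqS : ∀ a ∈ S, ‖a - q * a‖ ≤ δ * (2 * (C * Z) + 1) := fun a ha =>
    norm_sub_mul_le_of_mem_convexHull (by rintro _ ⟨n, hn, rfl⟩; exact hl n hn a ha) hq
  have hq₁ : ‖q‖ ≤ 1 := norm_le_of_mem_convexHull (by rintro _ ⟨n, _, rfl⟩; exact hj₁ n) hq
  have hqπ : π q = 0 := mem_of_mem_convexHull (I := LinearMap.ker (π : A →ₗ[ℂ] B))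
    (by rintro _ ⟨n, _, rfl⟩; exact hjπ n) hq
  have hfin : δ * (2 * (C * Z) + 1) + δ * (C * Z) ≤ ε := by nlinarith
  -- `[(1 - q) w, x] = (1 - q) [w, x] - [q, x] w`, with the analogous formula for displacements. As
  -- `π q = 0`, the image is still `π c * z`.
  refine ⟨w - q * w, ?_, fun x hx => ?_, fun g hg => ?_, ?_⟩
  · have h2 : ‖q * w‖ ≤ 1 * ‖w‖ := (norm_mul_le _ _).trans (by gcongr)
    linarith [norm_sub_le w (q * w)]
  · have e : ȷ (w - q * w) * x - x * ȷ (w - q * w) =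
        ȷ (x.snd w - x.fst w - q * (x.snd w - x.fst w)) - (ȷ q * x - x * ȷ q) * ȷ w := by
      simp only [map_sub, map_mul, ← DoubleCentralizer.mul_coeHom, ← DoubleCentralizer.coeHom_mul]
      noncomm_ring
    rw [e]
    refine (norm_sub_le _ _).trans (le_trans (add_le_add ?_ ?_) hfin)
    · rw [DoubleCentralizer.norm_coeHom]
      exact hqS _ (Or.inl ⟨x, hx, rfl⟩)
    · refine (norm_mul_le _ _).trans ?_
      rw [DoubleCentralizer.norm_coeHom]
      gcongr
      exact hqF x hx
  · have e : α.aut g (w - q * w) - (w - q * w) =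
        (α.aut g w - w - q * (α.aut g w - w)) - (α.aut g q - q) * α.aut g w := by
      simp only [map_sub, map_mul]
      noncomm_ring
    rw [e]
    refine (norm_sub_le _ _).trans (le_trans (add_le_add ?_ ?_) hfin)
    · exact hqS _ (Or.inr ⟨g, hg, rfl⟩)
    · refine (norm_mul_le _ _).trans ?_
      rw [α.norm_aut]
      gcongr
      exact hqK g hg
  · have e : ȷ (π f) * (ȷ (π (w - q * w)) - z) = -(ȷ (π (f - f * c)) * z) := by
      rw [map_sub π w, map_mul π q, hqπ, zero_mul, sub_zero, hw', map_sub π, map_mul π, map_sub,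
        map_mul]
      noncomm_ring
    rw [e, norm_neg]
    refine (norm_mul_le _ _).trans ?_
    rw [DoubleCentralizer.norm_coeHom]
    have : ‖π (f - f * c)‖ ≤ δ := (hbd _).trans hcf
    calc _ ≤ δ * Z := by gcongr
      _ ≤ ε := by nlinarith

end QuasicentralSequence

/-! ### Strict convergence -/

section StrictSum

variable {A : Type*} [NonUnitalCStarAlgebra A]

/-- Pointwise limits of bounded operators are bounded by Banach–Steinhaus, and centrality passes to
the limit. -/
theorem DoubleCentralizer.exists_tendsto_fst (m : ℕ → 𝓜(ℂ, A))
    (h₁ : ∀ a, CauchySeq fun n => (m n).fst a) (h₂ : ∀ a, CauchySeq fun n => (m n).snd a) :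
    ∃ y : 𝓜(ℂ, A), ∀ a, Tendsto (fun n => (m n).fst a) atTop (𝓝 (y.fst a)) := by
  choose l hl using fun a => cauchySeq_tendsto_of_complete (h₁ a)
  choose r hr using fun a => cauchySeq_tendsto_of_complete (h₂ a)
  refine ⟨{ fst := continuousLinearMapOfTendsto (fun n => (m n).fst) (tendsto_pi_nhds.2 hl)
            snd := continuousLinearMapOfTendsto (fun n => (m n).snd) (tendsto_pi_nhds.2 hr)
            central := fun a b => ?_ }, hl⟩
  refine tendsto_nhds_unique ((hr a).mul_const b) ?_
  simp only [(m _).central]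
  exact (hl b).const_mul a

/-- The criterion by which strict sums are shown to lie in the algebra itself. -/
theorem DoubleCentralizer.eq_coeHom_tsum {m : 𝓜(ℂ, A)} {s : ℕ → A} (hs : Summable s)
    (h : ∀ a, Tendsto (fun N => ∑ n ∈ Finset.range N, s n * a) atTop (𝓝 (m.fst a))) :
    m = ȷ (∑' n, s n) := by
  refine ext_of_fst fun a => tendsto_nhds_unique (h a) ?_
  have := (hs.hasSum.tendsto_sum_nat).mul_const a
  simpa [Finset.sum_mul] using this

variable [PartialOrder A] [StarOrderedRing A]

/-- Cauchy–Schwarz separates `∑ f n * f n`, of norm at most 2, from `∑ a* f n y n* y n f n a ≤ R² a*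
(E M - E N) a`, which is small because `E n * a` converges. -/
theorem cauchySeq_sum_conj_mul {E f y : ℕ → A} {R : ℝ} (hf : ∀ n, IsSelfAdjoint (f n))
    (hfE : ∀ n, f n * f n = E (n + 1) - E n) (hE₁ : ∀ n, ‖E n‖ ≤ 1)
    (hE : ∀ a, Tendsto (fun n => E n * a) atTop (𝓝 a)) (hy : ∀ n, ‖y n‖ ≤ R) (a : A) :
    CauchySeq fun N => ∑ n ∈ Finset.range N, f n * y n * f n * a := by
  have hsum : ∀ N M, N ≤ M → ∑ n ∈ Finset.Ico N M, f n * f n = E M - E N := fun N M h => by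
    simp only [hfE, Finset.sum_Ico_sub E h]
  have hR : 0 ≤ R := (norm_nonneg _).trans (hy 0)
  have key : ∀ N M, N ≤ M → ‖∑ n ∈ Finset.Ico N M, f n * y n * f n * a‖ ^ 2 ≤
      2 * (R ^ 2 * ‖a‖ * ‖E M * a - E N * a‖) := by
    intro N M hNM
    have h := norm_sum_star_mul_sq_le (Finset.Ico N M) f fun n => y n * f n * a
    simp only [(hf _).star_eq, hsum N M hNM, ← mul_assoc] at h
    refine h.trans (mul_le_mul ?_ ?_ (norm_nonneg _) zero_le_two)
    · exact (norm_sub_le _ _).trans (by linarith [hE₁ N, hE₁ M])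
    · have hle : ∑ n ∈ Finset.Ico N M, star (y n * f n * a) * y n * f n * a ≤
          (R ^ 2) • (star a * (E M * a - E N * a)) := by
        rw [← sub_mul, ← hsum N M hNM, Finset.sum_mul, Finset.mul_sum, Finset.smul_sum]
        refine Finset.sum_le_sum fun n _ => ?_
        have h1 := CStarAlgebra.star_left_conjugate_le_norm_smul (a := f n * a)
          (b := star (y n) * y n) (IsSelfAdjoint.star_mul_self _)
        have h2 : ‖star (y n) * y n‖ • (star (f n * a) * (f n * a)) ≤
            (R ^ 2) • (star (f n * a) * (f n * a)) := by
          refine smul_le_smul_of_nonneg_right ?_ (star_mul_self_nonneg _)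
          rw [CStarRing.norm_star_mul_self, ← sq]
          have := hy n
          gcongr
        have h3 := h1.trans h2
        simp only [star_mul, (hf n).star_eq, mul_assoc] at h3 ⊢
        exact h3
      have h0 : 0 ≤ ∑ n ∈ Finset.Ico N M, star (y n * f n * a) * y n * f n * a :=
        Finset.sum_nonneg fun n _ => by
          have := star_mul_self_nonneg (y n * f n * a)
          simpa only [mul_assoc] using this
      refine (CStarAlgebra.norm_le_norm_of_nonneg_of_le h0 hle).trans ?_
      rw [norm_smul, Real.norm_of_nonneg (by positivity), mul_assoc]
      gcongr
      exact (norm_mul_le _ _).trans (by rw [norm_star])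
  rw [Metric.cauchySeq_iff']
  intro ε hε
  obtain ⟨N, hN⟩ := Metric.cauchySeq_iff'.1 (hE a).cauchySeq (ε ^ 2 / (2 * (R ^ 2 * ‖a‖ + 1)))
    (by positivity)
  refine ⟨N, fun M hM => ?_⟩
  rw [dist_eq_norm, ← Finset.sum_Ico_eq_sub _ hM]
  refine lt_of_pow_lt_pow_left₀ 2 hε.le ((key N M hM).trans_lt ?_)
  have h1 := hN M hM
  rw [dist_eq_norm, lt_div_iff₀ (by positivity)] at h1
  nlinarith [norm_nonneg (E M * a - E N * a)]

/-- Strict convergence of `∑ f n * y n * f n` for bounded `y` when `∑ f n ^ 2` converges strictly. -/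
theorem DoubleCentralizer.exists_strict_sum {E f y : ℕ → A} {R : ℝ}
    (hf : ∀ n, IsSelfAdjoint (f n)) (hfE : ∀ n, f n * f n = E (n + 1) - E n)
    (hE₁ : ∀ n, ‖E n‖ ≤ 1) (hE : ∀ a, Tendsto (fun n => E n * a) atTop (𝓝 a))
    (hy : ∀ n, ‖y n‖ ≤ R) :
    ∃ m : 𝓜(ℂ, A), ∀ a, Tendsto (fun N => ∑ n ∈ Finset.range N, f n * y n * f n * a) atTop
      (𝓝 (m.fst a)) := by
  obtain ⟨m, hm⟩ := DoubleCentralizer.exists_tendsto_fst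
    (fun N => ȷ (∑ n ∈ Finset.range N, f n * y n * f n))
    (fun a => by
      refine Eq.mp (congrArg CauchySeq (funext fun N => ?_))
        (cauchySeq_sum_conj_mul hf hfE hE₁ hE hy a)
      exact (Finset.sum_mul _ _ a).symm)
    (fun a => by
      -- The right action is the adjoint of the left action with `star (y n)` at `star a`.
      have h := cauchySeq_sum_conj_mul hf hfE hE₁ hE (y := fun n => star (y n))
        (fun n => (norm_star _).trans_le (hy n)) (star a)
      have h' := (starₗᵢ ℝ : A ≃ₗᵢ[ℝ] A).isometry.uniformContinuous.comp_cauchySeq h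
      refine Eq.mp (congrArg CauchySeq (funext fun N => ?_)) h'
      refine Eq.trans ?_ (Finset.mul_sum _ _ a).symm
      simp [(hf _).star_eq, mul_assoc])
  exact ⟨m, fun a => (hm a).congr fun N => Finset.sum_mul _ _ a⟩

end StrictSum

/-! ### Series of commutators and displacements -/

section Series

variable {G A B : Type*} [Group G] [TopologicalSpace G]
  [NonUnitalCStarAlgebra A] [NonUnitalCStarAlgebra B]

theorem DoubleCentralizer.tendsto_sum_commutator {m : 𝓜(ℂ, A)} {t : ℕ → A}
    (h : ∀ a, Tendsto (fun N => ∑ n ∈ Finset.range N, t n * a) atTop (𝓝 (m.fst a)))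
    (x : 𝓜(ℂ, A)) (a : A) :
    Tendsto (fun N => ∑ n ∈ Finset.range N, (x.snd (t n) - x.fst (t n)) * a) atTop
      (𝓝 ((m * x - x * m).fst a)) := by
  have := (h (x.fst a)).sub ((x.fst.continuous.tendsto _).comp (h a))
  refine this.congr fun N => ?_
  simp [sub_mul, x.central, DoubleCentralizer.fst_mul]

theorem CStarAction.tendsto_sum_aut_sub (α : CStarAction G A) {m : 𝓜(ℂ, A)} {t : ℕ → A}
    (h : ∀ a, Tendsto (fun N => ∑ n ∈ Finset.range N, t n * a) atTop (𝓝 (m.fst a)))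
    (g : G) (a : A) :
    Tendsto (fun N => ∑ n ∈ Finset.range N, (α.aut g (t n) - t n) * a) atTop
      (𝓝 ((α.onMultiplier g m - m).fst a)) := by
  have hc : Continuous (α.aut g) :=
    (AddMonoidHomClass.isometry_of_norm (α.aut g) (α.norm_aut g)).continuous
  have := ((hc.tendsto _).comp (h (α.aut g⁻¹ a))).sub (h a)
  rw [← α.onMultiplier_fst, α.aut_aut_inv] at this
  refine this.congr fun N => ?_
  simp only [Function.comp_apply, map_sum, map_mul, α.aut_aut_inv, sub_mul, Finset.sum_sub_distrib]

theorem multiplierMap_onMultiplier (α : CStarAction G A) (β : CStarAction G B)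
    (π : A →⋆ₙₐ[ℂ] B) (hπ : Function.Surjective π) (hG : ∀ g a, π (α.aut g a) = β.aut g (π a))
    (g : G) (m : 𝓜(ℂ, A)) :
    multiplierMap π hπ (α.onMultiplier g m) = β.onMultiplier g (multiplierMap π hπ m) := by
  refine DoubleCentralizer.ext_of_fst fun b => ?_
  obtain ⟨a, rfl⟩ := hπ b
  rw [← α.aut_aut_inv g a, multiplierMap_fst, α.onMultiplier_fst, hG, hG, β.onMultiplier_fst,
    multiplierMap_fst]

/-- On `K k` the bound `b n` holds once `n ≥ k`; the finitely many earlier terms are at most `2 * ‖t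
n‖`. The series is therefore uniformly convergent on each `K k`, and the interiors of these sets
cover G. -/
theorem CStarAction.continuous_tsum_aut_sub [WeaklyLocallyCompactSpace G] [SigmaCompactSpace G]
    (α : CStarAction G A) (K : CompactExhaustion G) {t : ℕ → A} {b : ℕ → ℝ} (hb : Summable b)
    (h : ∀ n, ∀ g ∈ K n, ‖α.aut g (t n) - t n‖ ≤ b n) :
    (∀ g, Summable fun n => α.aut g (t n) - t n) ∧
      Continuous fun g => ∑' n, (α.aut g (t n) - t n) := by
  have key : ∀ k, ∃ b' : ℕ → ℝ, Summable b' ∧ ∀ n, ∀ g ∈ K k, ‖α.aut g (t n) - t n‖ ≤ b' n := by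
    intro k
    refine ⟨fun n => if n < k then 2 * ‖t n‖ else b n, ?_, fun n g hg => ?_⟩
    · refine (summable_congr_cofinite ?_).1 hb
      rw [Nat.cofinite_eq_atTop]
      filter_upwards [eventually_ge_atTop k] with n hn
      rw [if_neg hn.not_gt]
    · simp only
      split_ifs with hn
      · have := norm_sub_le (α.aut g (t n)) (t n)
        rw [α.norm_aut] at this
        linarith
      · exact h n g (K.subset (not_lt.1 hn) hg)
  refine ⟨fun g => ?_, continuous_iff_continuousAt.2 fun g => ?_⟩
  · obtain ⟨k, hk⟩ := K.exists_mem g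
    obtain ⟨b', hb', hle⟩ := key k
    exact .of_norm_bounded hb' fun n => hle n g hk
  · obtain ⟨k, hk⟩ := K.exists_mem g
    obtain ⟨b', hb', hle⟩ := key (k + 1)
    have := continuousOn_tsum (s := K (k + 1))
      (fun n => ((α.continuous_apply (t n)).sub continuous_const).continuousOn) hb' hle
    exact this.continuousAt (mem_interior_iff_mem_nhds.1 (K.subset_interior_succ k hk))

/-- Passes from unitaries, where the square root estimate holds, to their linear combinations. -/
theorem summable_norm_commutator_sum_smul {D ι : Type*} [NormedRing D] [NormedAlgebra ℂ D]
    [Fintype ι] {w : ℕ → D} (c : ι → ℂ) (u : ι → D)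
    (h : ∀ i, Summable fun n => ‖w n * u i - u i * w n‖) :
    Summable fun n => ‖w n * (∑ i, c i • u i) - (∑ i, c i • u i) * w n‖ := by
  refine .of_nonneg_of_le (fun _ => norm_nonneg _) (fun n => ?_)
    (summable_sum fun i (_ : i ∈ Finset.univ) => (h i).mul_left ‖c i‖)
  rw [Finset.mul_sum, Finset.sum_mul, ← Finset.sum_sub_distrib]
  refine (norm_sum_le _ _).trans (Finset.sum_le_sum fun i _ => ?_)
  rw [mul_smul_comm, smul_mul_assoc, ← smul_sub, norm_smul]

end Series

/-! ### Norm estimates for roots and conjugates -/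

section Estimates

variable {G A B : Type*} [Group G] [TopologicalSpace G]
  [NonUnitalCStarAlgebra A] [NonUnitalCStarAlgebra B]

theorem DoubleCentralizer.norm_commutator_sq_le [PartialOrder A] [StarOrderedRing A] {f : A}
    (hf : 0 ≤ f) {u : 𝓜(ℂ, A)} (hu : u ∈ unitary 𝓜(ℂ, A)) :
    ‖ȷ f * u - u * ȷ f‖ ^ 2 ≤ ‖ȷ (f * f) * u - u * ȷ (f * f)‖ := by
  let _ := CStarAlgebra.spectralOrder 𝓜(ℂ, A)
  have := CStarAlgebra.spectralOrderedRing 𝓜(ℂ, A)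
  rw [map_mul]
  exact norm_mul_sub_mul_sq_le (map_nonneg (DoubleCentralizer.coeHom (𝕜 := ℂ) (A := A)) hf) hu

theorem CStarAction.norm_aut_sub_sq_le [PartialOrder A] [StarOrderedRing A] (α : CStarAction G A)
    {f : A} (hf : 0 ≤ f) (g : G) : ‖α.aut g f - f‖ ^ 2 ≤ ‖α.aut g (f * f) - f * f‖ := by
  let _ := CStarAlgebra.spectralOrder 𝓜(ℂ, A)
  have := CStarAlgebra.spectralOrderedRing 𝓜(ℂ, A)
  rw [← DoubleCentralizer.norm_coeHom (_ - f), ← DoubleCentralizer.norm_coeHom (_ - f * f),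
    map_sub, map_sub, map_mul, map_mul, map_mul]
  exact norm_sub_sq_le_norm_mul_self_sub
    (map_nonneg (DoubleCentralizer.coeHom (𝕜 := ℂ) (A := A)) (map_nonneg (α.aut g) hf))
    (map_nonneg (DoubleCentralizer.coeHom (𝕜 := ℂ) (A := A)) hf)

theorem norm_conj_commutator_le {D : Type*} [NormedRing D] {f y x : D} {r R : ℝ}
    (hf : ‖f‖ ≤ r) (hy : ‖y‖ ≤ R) :
    ‖f * y * f * x - x * (f * y * f)‖ ≤
      2 * (r * R) * ‖f * x - x * f‖ + r * r * ‖y * x - x * y‖ := by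
  have hr := (norm_nonneg f).trans hf
  have hR := (norm_nonneg y).trans hy
  have e : f * y * f * x - x * (f * y * f) =
      f * y * (f * x - x * f) + f * (y * x - x * y) * f + (f * x - x * f) * (y * f) := by
    noncomm_ring
  have h1 : ‖f * y * (f * x - x * f)‖ ≤ r * R * ‖f * x - x * f‖ :=
    norm_mul_le_of_le (norm_mul_le_of_le hf hy) le_rfl
  have h2 : ‖f * (y * x - x * y) * f‖ ≤ r * ‖y * x - x * y‖ * r :=
    norm_mul_le_of_le (norm_mul_le_of_le hf le_rfl) hf
  have h3 : ‖(f * x - x * f) * (y * f)‖ ≤ ‖f * x - x * f‖ * (R * r) :=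
    norm_mul_le_of_le le_rfl (norm_mul_le_of_le hy hf)
  rw [e]
  refine (norm_add₃_le).trans ?_
  nlinarith

theorem CStarAction.norm_aut_conj_sub_le (α : CStarAction G A) (g : G) {f y : A} {r R : ℝ}
    (hf : ‖f‖ ≤ r) (hy : ‖y‖ ≤ R) :
    ‖α.aut g (f * y * f) - f * y * f‖ ≤
      2 * (r * R) * ‖α.aut g f - f‖ + r * r * ‖α.aut g y - y‖ := by
  have hf' : ‖α.aut g f‖ ≤ r := (α.norm_aut g f).trans_le hf
  have hy' : ‖α.aut g y‖ ≤ R := (α.norm_aut g y).trans_le hy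
  have e : α.aut g (f * y * f) - f * y * f = (α.aut g f - f) * (α.aut g y * α.aut g f) +
      f * (α.aut g y - y) * α.aut g f + f * y * (α.aut g f - f) := by
    simp only [map_mul]
    noncomm_ring
  have h1 : ‖(α.aut g f - f) * (α.aut g y * α.aut g f)‖ ≤ ‖α.aut g f - f‖ * (R * r) :=
    norm_mul_le_of_le le_rfl (norm_mul_le_of_le hy' hf')
  have h2 : ‖f * (α.aut g y - y) * α.aut g f‖ ≤ r * ‖α.aut g y - y‖ * r :=
    norm_mul_le_of_le (norm_mul_le_of_le hf le_rfl) hf'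
  have h3 : ‖f * y * (α.aut g f - f)‖ ≤ r * R * ‖α.aut g f - f‖ :=
    norm_mul_le_of_le (norm_mul_le_of_le hf hy) le_rfl
  rw [e]
  refine (norm_add₃_le).trans ?_
  nlinarith

end Estimates

/-! ### The lift modulo `A` -/

section Lift

variable {G A B : Type*} [Group G] [TopologicalSpace G] [IsTopologicalGroup G]
  [LocallyCompactSpace G] [SigmaCompactSpace G]
  [NonUnitalCStarAlgebra A] [NonUnitalCStarAlgebra B]

/-- Lifting a `G`-invariant multiplier of `B` to a multiplier of `A` that commutes with the given
sequence and is `G`-invariant modulo `A`. -/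
theorem CStarAction.exists_lift_modulo [PartialOrder A] [StarOrderedRing A]
    (α : CStarAction G A) (β : CStarAction G B)
    (π : A →⋆ₙₐ[ℂ] B) (hπ : Function.Surjective π) (hG : ∀ g a, π (α.aut g a) = β.aut g (π a))
    {e j : ℕ → A} (hmono : Monotone e) (he₀ : ∀ n, 0 ≤ e n) (he₁ : ∀ n, ‖e n‖ ≤ 1)
    (he : ∀ a, Tendsto (fun n => e n * a) atTop (𝓝 a))
    (hjsa : ∀ n, IsSelfAdjoint (j n)) (hj₁ : ∀ n, ‖j n‖ ≤ 1) (hjπ : ∀ n, π (j n) = 0)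
    (hj : ∀ a, π a = 0 → Tendsto (fun n => j n * a) atTop (𝓝 a))
    (x : ℕ → 𝓜(ℂ, A)) (z : 𝓜(ℂ, B)) (hz : ∀ g, β.onMultiplier g z = z)
    (hx : ∀ k, multiplierMap π hπ (x k) * z = z * multiplierMap π hπ (x k)) :
    ∃ y : 𝓜(ℂ, A), (multiplierMap π hπ y - z ∈ Set.range (ȷ : B → 𝓜(ℂ, B))) ∧
      (∀ k, y * x k - x k * y ∈ Set.range (ȷ : A → 𝓜(ℂ, A))) ∧
      (∀ g, α.onMultiplier g y - y ∈ Set.range (ȷ : A → 𝓜(ℂ, A))) ∧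
      Continuous fun g => α.onMultiplier g y := by
  classical
  let K : CompactExhaustion G := CompactExhaustion.choice G
  choose U c hUc _ using fun k => CStarAlgebra.exists_sum_four_unitary (x k)
  obtain ⟨V, d, hVd, -⟩ := CStarAlgebra.exists_sum_four_unitary z
  let F : ℕ → Finset 𝓜(ℂ, A) := fun n =>
    (Finset.range (n + 1) ×ˢ Finset.univ).image fun p : ℕ × Fin 4 => (U p.1 p.2 : 𝓜(ℂ, A))
  have hF : ∀ {n k} (i), k ≤ n → (U k i : 𝓜(ℂ, A)) ∈ F n := fun {n k} i hk =>
    Finset.mem_image.2 ⟨(k, i), by simp [hk], rfl⟩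
  let T : Finset 𝓜(ℂ, B) := Finset.univ.image fun i => (V i : 𝓜(ℂ, B))
  -- The square root turns errors of order `(1/4)^n` into `(1/2)^n`, which are still summable.
  obtain ⟨E, hEmono, -, hE₁, hE, hEF, hET, hEK⟩ := α.exists_monotone_quasicentral π hπ hmono he₀
    he₁ he F (fun _ => T) (K := K) K.isCompact (ε := fun n => (1 / 4 : ℝ) ^ n)
    (fun n => by positivity)
  have hd : ∀ n, 0 ≤ E (n + 1) - E n := fun n => sub_nonneg.2 (hEmono n.le_succ)
  set f : ℕ → A := fun n => CFC.sqrt (E (n + 1) - E n)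
  have hf₀ : ∀ n, 0 ≤ f n := fun n => CFC.sqrt_nonneg _
  have hff : ∀ n, f n * f n = E (n + 1) - E n := fun n => CFC.sqrt_mul_sqrt_self _ (hd n)
  have hf₁ : ∀ n, ‖f n‖ ≤ 2 := fun n => by
    have h1 : ‖f n‖ * ‖f n‖ = ‖E (n + 1) - E n‖ := by
      rw [← CStarRing.norm_star_mul_self, (hf₀ n).isSelfAdjoint.star_eq, hff]
    have h2 := norm_sub_le (E (n + 1)) (E n)
    nlinarith [hE₁ n, hE₁ (n + 1), norm_nonneg (f n)]
  have hgeom : ∀ {n : ℕ} {s t v : ℝ}, s ^ 2 ≤ t + v → t ≤ (1 / 4 : ℝ) ^ (n + 1) →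
      v ≤ (1 / 4 : ℝ) ^ n → s ≤ 2 * (1 / 2 : ℝ) ^ n := by
    intro n s t v hs ht hv
    refine (abs_le_of_sq_le_sq' ?_ (by positivity)).2
    have : (1 / 4 : ℝ) ^ n = ((1 / 2 : ℝ) ^ n) ^ 2 := by rw [← pow_mul, mul_comm, pow_mul]; norm_num
    have h0 : 0 < (1 / 4 : ℝ) ^ n := by positivity
    rw [pow_succ] at ht
    rw [mul_pow, ← this]
    linarith
  have hfU : ∀ {n k} (i), k ≤ n → ‖ȷ (f n) * U k i - U k i * ȷ (f n)‖ ≤ 2 * (1 / 2 : ℝ) ^ n := by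
    intro n k i hk
    refine hgeom ((DoubleCentralizer.norm_commutator_sq_le (hf₀ n) (U k i).2).trans ?_)
      (hEF (n + 1) _ (hF i (hk.trans n.le_succ))) (hEF n _ (hF i hk))
    rw [hff, map_sub]
    refine le_trans (le_of_eq ?_) (norm_sub_le _ _)
    congr 1
    noncomm_ring
  have hfV : ∀ n i, ‖ȷ (π (f n)) * V i - V i * ȷ (π (f n))‖ ≤ 2 * (1 / 2 : ℝ) ^ n := by
    intro n i
    have hV : (V i : 𝓜(ℂ, B)) ∈ T := Finset.mem_image.2 ⟨i, Finset.mem_univ i, rfl⟩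
    let _ := CStarAlgebra.spectralOrder B
    have := CStarAlgebra.spectralOrderedRing B
    refine hgeom ((DoubleCentralizer.norm_commutator_sq_le (map_nonneg π (hf₀ n)) (V i).2).trans ?_)
      (hET (n + 1) _ hV) (hET n _ hV)
    rw [← map_mul, hff, map_sub, map_sub]
    refine le_trans (le_of_eq ?_) (norm_sub_le _ _)
    congr 1
    noncomm_ring
  have hfK : ∀ n, ∀ g ∈ K n, ‖α.aut g (f n) - f n‖ ≤ 2 * (1 / 2 : ℝ) ^ n := by
    intro n g hg
    refine hgeom ((α.norm_aut_sub_sq_le (hf₀ n) g).trans ?_)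
      (hEK (n + 1) g (K.subset n.le_succ hg)) (hEK n g hg)
    rw [hff, map_sub]
    refine le_trans (le_of_eq ?_) (norm_sub_le _ _)
    congr 1
    abel
  obtain ⟨R, hR⟩ := α.exists_approx_lift β π hπ hG (fun n => (he₀ n).isSelfAdjoint) he₁ he
    hjsa hj₁ hjπ hj z hz
  choose y hyR hyx hyK hyz using fun n => hR (f n) ((Finset.range (n + 1)).image x) (K n)
    ((1 / 2 : ℝ) ^ n) (K.isCompact n) (by positivity) (fun v hv => by
      obtain ⟨k, -, rfl⟩ := Finset.mem_image.1 hv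
      exact hx k)
  obtain ⟨m, hm⟩ := DoubleCentralizer.exists_strict_sum (fun n => (hf₀ n).isSelfAdjoint) hff hE₁
    hE hyR
  have hpow : Summable fun n : ℕ => (1 / 2 : ℝ) ^ n := summable_geometric_two
  have hsum : ∀ {s : ℕ → ℝ} (C : ℝ) (k : ℕ), (∀ n, 0 ≤ s n) →
      (∀ n, k ≤ n → s n ≤ C * (1 / 2 : ℝ) ^ n) → Summable s := by
    intro s C k h0 h
    refine .of_norm_bounded_eventually_nat (hpow.mul_left C) ?_
    filter_upwards [eventually_ge_atTop k] with n hn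
    rw [Real.norm_of_nonneg (h0 n)]
    exact h n hn
  have hcomm : ∀ k, m * x k - x k * m ∈ Set.range (ȷ : A → 𝓜(ℂ, A)) := by
    intro k
    refine ⟨_, (DoubleCentralizer.eq_coeHom_tsum ?_
      (DoubleCentralizer.tendsto_sum_commutator hm (x k))).symm⟩
    have h1 : Summable fun n => ‖ȷ (f n) * x k - x k * ȷ (f n)‖ := by
      have := summable_norm_commutator_sum_smul (w := fun n => ȷ (f n)) (c k)
        (fun i => (U k i : 𝓜(ℂ, A))) fun i => hsum 2 k (fun _ => norm_nonneg _) fun n hn => hfU i hn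
      rwa [← hUc k] at this
    have h2 : Summable fun n => ‖ȷ (y n) * x k - x k * ȷ (y n)‖ :=
      hsum 1 k (fun _ => norm_nonneg _) fun n hn => by
        rw [one_mul]
        exact hyx n _ (Finset.mem_image.2 ⟨k, by simpa [Nat.lt_succ_iff] using hn, rfl⟩)
    refine .of_norm_bounded ((h1.mul_left (2 * (2 * R))).add (h2.mul_left (2 * 2))) fun n => ?_
    rw [← DoubleCentralizer.norm_coeHom, map_sub, ← DoubleCentralizer.mul_coeHom,
      ← DoubleCentralizer.coeHom_mul, map_mul, map_mul]
    exact norm_conj_commutator_le ((DoubleCentralizer.norm_coeHom _).trans_le (hf₁ n))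
      ((DoubleCentralizer.norm_coeHom _).trans_le (hyR n))
  obtain ⟨hGsum, hGcont⟩ := α.continuous_tsum_aut_sub K (t := fun n => f n * y n * f n)
    (hpow.mul_left (2 * (2 * R) * 2 + 2 * 2)) fun n g hg => by
      refine (α.norm_aut_conj_sub_le g (hf₁ n) (hyR n)).trans ?_
      have h1 := hfK n g hg
      have h2 := hyK n g hg
      have hR0 := (norm_nonneg _).trans (hyR 0)
      nlinarith
  have hGm : ∀ g, α.onMultiplier g m - m =
      ȷ (∑' n, (α.aut g (f n * y n * f n) - f n * y n * f n)) :=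
    fun g => DoubleCentralizer.eq_coeHom_tsum (hGsum g) (α.tendsto_sum_aut_sub hm g)
  refine ⟨m, ?_, hcomm, fun g => ⟨_, (hGm g).symm⟩, ?_⟩
  · have hsummable : Summable fun n => π (f n * y n * f n) - z.snd (π (f n * f n)) := by
      have h1 : Summable fun n => ‖ȷ (π (f n)) * z - z * ȷ (π (f n))‖ := by
        have := summable_norm_commutator_sum_smul (w := fun n => ȷ (π (f n))) d
          (fun i => (V i : 𝓜(ℂ, B))) fun i => hsum 2 0 (fun _ => norm_nonneg _) fun n _ => hfV n i
        rwa [← hVd] at this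
      refine .of_norm_bounded ((hpow.mul_right 2).add (h1.mul_left 2)) fun n => ?_
      have hπf : ‖ȷ (π (f n))‖ ≤ 2 := by
        rw [DoubleCentralizer.norm_coeHom]
        exact (NonUnitalStarAlgHom.norm_apply_le π _).trans (hf₁ n)
      have e : ȷ (π (f n * y n * f n) - z.snd (π (f n * f n))) =
          ȷ (π (f n)) * (ȷ (π (y n)) - z) * ȷ (π (f n)) -
            ȷ (π (f n)) * (ȷ (π (f n)) * z - z * ȷ (π (f n))) := by
        rw [map_sub, ← DoubleCentralizer.coeHom_mul]
        simp only [map_mul]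
        noncomm_ring
      rw [← DoubleCentralizer.norm_coeHom, e]
      exact (norm_sub_le _ _).trans (add_le_add (norm_mul_le_of_le (hyz n) hπf)
        (norm_mul_le_of_le hπf le_rfl))
    -- The sum of the `f n * f n` telescopes to `1 - E 0`, which leaves the correction `π (E 0) *
    -- z`, an element of `B`.
    have hlim : multiplierMap π hπ m - z + ȷ (π (E 0)) * z =
        ȷ (∑' n, (π (f n * y n * f n) - z.snd (π (f n * f n)))) := by
      refine DoubleCentralizer.eq_coeHom_tsum hsummable fun b => ?_
      obtain ⟨a, rfl⟩ := hπ b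
      obtain ⟨a', ha'⟩ := hπ (z.fst (π a))
      have hcont : Continuous π := map_continuous π
      have h := ((hcont.tendsto _).comp (hm a)).sub
        ((hcont.tendsto _).comp ((hE a').sub_const (E 0 * a')))
      have e : (multiplierMap π hπ m - z + ȷ (π (E 0)) * z).fst (π a) =
          π (m.fst a) - π (a' - E 0 * a') := by
        change (multiplierMap π hπ m).fst (π a) - z.fst (π a) + π (E 0) * z.fst (π a) = _
        rw [multiplierMap_fst, ← ha', map_sub, map_mul]
        abel
      rw [e]
      refine h.congr fun N => ?_
      have htel : ∑ n ∈ Finset.range N, f n * f n = E N - E 0 := by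
        simp only [hff, Finset.sum_range_sub E]
      simp only [Function.comp_apply, sub_mul, Finset.sum_sub_distrib, z.central, ← ha']
      simp only [← map_mul, ← map_sum, ← Finset.sum_mul, htel, sub_mul]
    refine ⟨(∑' n, (π (f n * y n * f n) - z.snd (π (f n * f n)))) - z.snd (π (E 0)), ?_⟩
    rw [map_sub, ← hlim, ← DoubleCentralizer.coeHom_mul, add_sub_cancel_right]
  · have := (DoubleCentralizer.isometry_coeHom.continuous.comp hGcont).add
      (continuous_const (y := m))
    refine this.congr fun g => ?_
    rw [Pi.add_apply, Function.comp_apply, ← hGm, sub_add_cancel]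

end Lift

/-! ### Correction by an element of `A` -/

/-- `B` embeds in `M(B)`, so `π°` vanishes on an element of `A` only if `π` does; exactness
concludes. -/
theorem IsEquivariantExtension.mem_idealInMultiplier {G J A B : Type*} [Group G]
    [TopologicalSpace G] [NonUnitalCStarAlgebra J] [NonUnitalCStarAlgebra A]
    [NonUnitalCStarAlgebra B] {γ : CStarAction G J} {α : CStarAction G A} {β : CStarAction G B}
    {ι : J →⋆ₙₐ[ℂ] A} {π : A →⋆ₙₐ[ℂ] B} (hext : IsEquivariantExtension γ α β ι π) {m : 𝓜(ℂ, A)}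
    (hm : m ∈ Set.range (ȷ : A → 𝓜(ℂ, A))) (hπ : multiplierMap π hext.surjective m = 0) :
    m ∈ idealInMultiplier ι := by
  obtain ⟨a, rfl⟩ := hm
  rw [multiplierMap_coeHom, ← norm_eq_zero, DoubleCentralizer.norm_coeHom, norm_eq_zero,
    hext.exact] at hπ
  obtain ⟨b, rfl⟩ := hπ
  exact ⟨b, rfl⟩

theorem proposition2p2 {G J A B : Type*}
    [Group G] [TopologicalSpace G] [IsTopologicalGroup G]
    [LocallyCompactSpace G] [SigmaCompactSpace G]
    [NonUnitalCStarAlgebra J] [NonUnitalCStarAlgebra A] [NonUnitalCStarAlgebra B]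
    (γ : CStarAction G J) (α : CStarAction G A) (β : CStarAction G B)
    (ι : J →⋆ₙₐ[ℂ] A) (π : A →⋆ₙₐ[ℂ] B) (hext : IsEquivariantExtension γ α β ι π)
    (hJ : IsSigmaUnital J) (hA : IsSigmaUnital A) (hB : IsSigmaUnital B)
    (X : Submodule ℂ 𝓜(ℂ, A)) (hXsep : TopologicalSpace.IsSeparable (X : Set 𝓜(ℂ, A)))
    (hXstar : ∀ x ∈ X, star x ∈ X)
    (z : 𝓜(ℂ, B))
    (hzX : z ∈ Set.centralizer (multiplierMap π hext.surjective '' (X : Set 𝓜(ℂ, A))))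
    (hzG : ∀ g : G, β.onMultiplier g z = z) :
    ∃ y : 𝓜(ℂ, A),
      multiplierMap π hext.surjective y = z ∧
      (∀ x ∈ X, y * x - x * y ∈ idealInMultiplier ι) ∧
      (∀ g : G, α.onMultiplier g y - y ∈ idealInMultiplier ι) ∧
      Continuous fun g : G => α.onMultiplier g y := by
  let _ : PartialOrder A := CStarAlgebra.spectralOrder A
  have : StarOrderedRing A := CStarAlgebra.spectralOrderedRing A
  let _ : PartialOrder J := CStarAlgebra.spectralOrder J
  have : StarOrderedRing J := CStarAlgebra.spectralOrderedRing J
  obtain ⟨e, hmono, he, hlim⟩ := hA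
  obtain ⟨j, -, hj, hjlim⟩ := hJ
  have hcomm : ∀ x ∈ X, multiplierMap π hext.surjective x * z =
      z * multiplierMap π hext.surjective x := fun x hx =>
    Set.mem_centralizer_iff.1 hzX _ ⟨x, hx, rfl⟩
  obtain ⟨t, htX, htc, hXt⟩ := hXsep.exists_countable_dense_subset
  have htne : t.Nonempty := closure_nonempty_iff.1 ⟨0, hXt X.zero_mem⟩
  obtain ⟨x, rfl⟩ := htc.exists_eq_range htne
  obtain ⟨y, hyz, hyx, hyG, hyc⟩ := α.exists_lift_modulo β π hext.surjective
    hext.equivariant_right hmono (fun n => (he n).1) (fun n => (he n).2)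
    (fun a => tendsto_map'_iff.1 (hlim.tendsto_mul_right a)) (j := fun n => ι (j n))
    (fun n => ((hj n).1.isSelfAdjoint).map ι)
    (fun n => (NonUnitalStarAlgHom.norm_apply_le ι _).trans (hj n).2)
    (fun n => (hext.exact _).2 ⟨_, rfl⟩)
    (fun a ha => by
      obtain ⟨b, rfl⟩ := (hext.exact a).1 ha
      have hcont : Continuous ι := map_continuous ι
      simpa [Function.comp_def] using
        (hcont.tendsto b).comp (tendsto_map'_iff.1 (hjlim.tendsto_mul_right b)))
    x z hzG (fun k => hcomm _ (htX ⟨k, rfl⟩))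
  -- `A` is norm closed in `M(A)`, so the dense sequence suffices.
  have hyX : ∀ v ∈ X, y * v - v * y ∈ Set.range (ȷ : A → 𝓜(ℂ, A)) := by
    have hcl : IsClosed {v | y * v - v * y ∈ Set.range (ȷ : A → 𝓜(ℂ, A))} :=
      DoubleCentralizer.isClosed_range_coeHom.preimage (by fun_prop)
    intro v hv
    exact closure_minimal (by rintro _ ⟨k, rfl⟩; exact hyx k) hcl (hXt hv)
  obtain ⟨b, hb⟩ := hyz
  obtain ⟨a, rfl⟩ := hext.surjective b
  have hlift : multiplierMap π hext.surjective (y - ȷ a) = z := by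
    rw [map_sub, multiplierMap_coeHom, hb, sub_sub_cancel]
  refine ⟨y - ȷ a, hlift, fun v hv => ?_, fun g => ?_, ?_⟩
  · refine hext.mem_idealInMultiplier ?_ ?_
    · obtain ⟨c, hc⟩ := hyX v hv
      refine ⟨c - (v.snd a - v.fst a), ?_⟩
      rw [map_sub, hc, map_sub, ← DoubleCentralizer.coeHom_mul, ← DoubleCentralizer.mul_coeHom]
      noncomm_ring
    · rw [map_sub, map_mul, map_mul, hlift, hcomm v hv, sub_self]
  · refine hext.mem_idealInMultiplier ?_ ?_
    · obtain ⟨c, hc⟩ := hyG g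
      refine ⟨c - (α.aut g a - a), ?_⟩
      rw [map_sub, hc, map_sub, map_sub, α.onMultiplier_coeHom]
      abel
    · rw [map_sub, multiplierMap_onMultiplier α β π hext.surjective hext.equivariant_right, hlift,
        hzG, sub_self]
  · simp only [map_sub, α.onMultiplier_coeHom]
    exact hyc.sub (DoubleCentralizer.isometry_coeHom.continuous.comp (α.continuous_apply a))
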